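/- Theorem 3.11. Let $\mathcal{A}$ and $\mathcal{B}$ be abelian categories with enough injectives, and let $\mathcal{A}'\subset\mathcal{A}$ and $\mathcal{B}'\subset\mathcal{B}$ be full abelian subcategories (that is, full subcategories that contain a zero object and are closed under kernels, cokernels and finite products taken in the ambient category, so that they are abelian with exact inclusion), closed under isomorphism in $\mathcal{A}$, respectively $\mathcal{B}$. Call a functor $T:\mathcal{C}\to\mathcal{D}$ between abelian categories effaceable if for every object $X$ of $\mathcal{C}$ there is a monomorphism $a:X\to Y$ in $\mathcal{C}$ such that $T(a)=0$. Assume: (1) for every object $A'$ of $\mathcal{A}'$ and every $q>0$, the functor $\operatorname{Ext}^q_{\mathcal{A}}(A',\cdot)|\mathcal{A}'$ is effaceable; (2) for every object $B'$ of $\mathcal{B}'$ and every $q>0$, the functor $\operatorname{Ext}^q_{\mathcal{B}}(B',\cdot)|\mathcal{B}'$ is effaceable; (3) $G:\mathcal{B}\to\mathcal{A}$ is a left exact additive functor such that $\operatorname{R}^qG(B')$ is an object of $\mathcal{A}'$ for every object $B'$ of $\mathcal{B}'$ and every $q\ge 0$; (4) $F:\mathcal{A}\to\mathcal{B}$ is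 a left adjoint of $G$, $F$ is left exact, and $F(A')$ is an object of $\mathcal{B}'$ for every object $A'$ of $\mathcal{A}'$. Then for every $e>0$ the functor $\operatorname{R}^eG|\mathcal{B}'$ is effaceable. -/

import Mathlib

open CategoryTheory CategoryTheory.Limits

universe v u v' u'

/-- A functor `T : C ⥤ D` is effaceable if every object `X` of `C` admits a monomorphism
`a : X ⟶ Y` in `C` such that `T a : T X ⟶ T Y` is the zero morphism. -/
def IsEffaceable {C : Type u} [Category.{v} C] {D : Type u'} [Category.{v'} D]
    [HasZeroMorphisms D] (T : C ⥤ D) : Prop :=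
  ∀ X : C, ∃ (Y : C) (a : X ⟶ Y), Mono a ∧ T.map a = 0

/-- Let `P` be a property of objects of an abelian category `C` with enough injectives, viewed as
a full subcategory of `C`. For every object `X` of this subcategory and every `q > 0`,
the functor `Ext^q_C(X, -)` restricted to the subcategory is effaceable.
(As `C` has enough injectives, its `Ext` groups live in the universe of the morphisms of `C`.) -/
def HasEffaceableExt {C : Type u} [Category.{v} C] [Abelian C] [EnoughInjectives C]
    (P : ObjectProperty C) : Prop :=
  haveI : HasExt.{v} C := hasExt_of_enoughInjectives.{v} C
  ∀ X : C, P X → ∀ q : ℕ, 0 < q → IsEffaceable (P.ι ⋙ Abelian.extFunctorObj.{v} X q)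

/-! Strong induction on `e = q + 1`, working with the cocycles Z and coboundaries B of `G` applied
to injective resolutions. As right adjoint of an exact functor, `G` preserves injectives, so the
sequences 0 → Z^q → (G I)^q → B^{q+1} → 0 shift Ext degrees. For `Y` in `B'` put X = R^{q+1}G(Y), an
object of `A'`.

Lower effaceability gives a mono Y → Z in `B'` killing Ext^2(X, Z^q)
(`exists_mono_extKills_cyclesMap`). Over Z the obstruction to lifting X → H^{q+1} to cocycles
vanishes (`exists_lift_cycles_of_extKills`). By adjunction the lift is a map from F X to cocycles of
an injective resolution of Z, so it represents a class in Ext^{q+1}(F X, Z). As F X lies in `B'`, a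
further mono Z → W effaces that class, and transposing back turns the lift into a coboundary
(`comp_homologyMap_eq_zero_of_extKills`). -/

section ExtKills

/-! ### Morphisms that kill Ext groups. -/

open Abelian

variable {C : Type u} [Category.{v} C] [Abelian C] [HasExt.{v} C]

/-- Postcomposition with `f : Y ⟶ Z` is the zero map `Ext X Y n → Ext X Z n`. -/
def ExtKills (X : C) (n : ℕ) {Y Z : C} (f : Y ⟶ Z) : Prop :=
  ∀ x : Ext.{v} X Y n, x.comp (Ext.mk₀ f) (add_zero n) = 0

lemma CategoryTheory.Abelian.Ext.comp_mk₀_comp {X Y Z W : C} {n : ℕ} (x : Ext.{v} X Y n) (f : Y ⟶ Z)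
    (g : Z ⟶ W) :
    x.comp (Ext.mk₀ (f ≫ g)) (add_zero n) =
      (x.comp (Ext.mk₀ f) (add_zero n)).comp (Ext.mk₀ g) (add_zero n) := by
  rw [← Ext.mk₀_comp_mk₀, Ext.comp_assoc _ _ _ (add_zero n) (add_zero 0) (by lia)]

lemma ExtKills.comp_left {X : C} {n : ℕ} {Y Z W : C} {g : Z ⟶ W} (h : ExtKills X n g)
    (f : Y ⟶ Z) : ExtKills X n (f ≫ g) := fun x ↦ by
  rw [Ext.comp_mk₀_comp, h]

lemma ExtKills.comp_right {X : C} {n : ℕ} {Y Z W : C} {f : Y ⟶ Z} (h : ExtKills X n f)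
    (g : Z ⟶ W) : ExtKills X n (f ≫ g) := fun x ↦ by
  rw [Ext.comp_mk₀_comp, h, Ext.zero_comp]

/-- Dimension shifting: if the middle term of the target sequence has no higher `Ext`, a class in
the right hand term dies as soon as the left hand map kills `Ext` one degree higher. -/
lemma ExtKills.shift {X : C} {n : ℕ} {S T : ShortComplex C} (hS : S.ShortExact)
    (hT : T.ShortExact) [Injective T.X₂] (φ : S ⟶ T) (hn : 0 < n)
    (h : ExtKills X (n + 1) φ.τ₁) : ExtKills X n φ.τ₃ := fun x ↦ by
  have hx : (x.comp (Ext.mk₀ φ.τ₃) (add_zero n)).comp hT.extClass rfl = 0 := by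
    rw [Ext.comp_assoc _ _ _ (add_zero n) (zero_add 1) (by lia),
      ← ShortComplex.ShortExact.extClass_naturality hS hT,
      ← Ext.comp_assoc _ _ _ rfl (add_zero 1) (by lia), h]
  obtain ⟨y, hy⟩ := Ext.covariant_sequence_exact₃ X hT _ rfl hx
  -- Injectivity kills Ext only in positive degree; this is where `0 < n` enters.
  obtain ⟨n, rfl⟩ := Nat.exists_eq_succ_of_ne_zero hn.ne'
  rw [← hy, Ext.eq_zero_of_injective y, Ext.zero_comp]

/-- If `φ.τ₁` kills `Ext¹` then the composite of a morphism to the right hand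
term with `φ.τ₃` lifts to the middle term. -/
lemma ExtKills.exists_lift {X : C} {S T : ShortComplex C} (hS : S.ShortExact)
    (hT : T.ShortExact) (φ : S ⟶ T) (h : ExtKills X 1 φ.τ₁) (t : X ⟶ S.X₃) :
    ∃ s : X ⟶ T.X₂, s ≫ T.g = t ≫ φ.τ₃ := by
  have hx : (Ext.mk₀ (t ≫ φ.τ₃)).comp hT.extClass (zero_add 1) = 0 := by
    rw [← Ext.mk₀_comp_mk₀, Ext.comp_assoc _ _ _ (add_zero 0) (zero_add 1) (by lia),
      ← ShortComplex.ShortExact.extClass_naturality hS hT,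
      ← Ext.comp_assoc _ _ _ (zero_add 1) (add_zero 1) (by lia), h]
  obtain ⟨y, hy⟩ := Ext.covariant_sequence_exact₃ X hT _ _ hx
  obtain ⟨s, rfl⟩ := (Ext.mk₀_bijective X T.X₂).surjective y
  refine ⟨s, (Ext.mk₀_bijective X T.X₃).injective ?_⟩
  rw [← hy, Ext.mk₀_comp_mk₀]

/-- If `φ.τ₃` vanishes and `ψ.τ₁` kills `Ext`, then so does the composite of the middle maps. -/
lemma ExtKills.comp_of_shortExact {X : C} {n : ℕ} {S T U : ShortComplex C}
    (hT : T.ShortExact) (φ : S ⟶ T) (ψ : T ⟶ U) (hφ : φ.τ₃ = 0)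
    (hψ : ExtKills X n ψ.τ₁) : ExtKills X n (φ.τ₂ ≫ ψ.τ₂) := fun x ↦ by
  obtain ⟨y, hy⟩ := Ext.covariant_sequence_exact₂ X hT (x.comp (Ext.mk₀ φ.τ₂) (add_zero n)) (by
    rw [← Ext.comp_mk₀_comp, φ.comm₂₃, hφ, comp_zero, Ext.mk₀_zero, Ext.comp_zero])
  rw [Ext.comp_mk₀_comp, ← hy, ← Ext.comp_mk₀_comp, ← ψ.comm₁₂, Ext.comp_mk₀_comp, hψ,
    Ext.zero_comp]

end ExtKills

/-! ### Cocycles, coboundaries and Ext. -/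

namespace CochainComplex

open HomologicalComplex

variable {C : Type u} [Category.{v} C] [Abelian C] (K L M : CochainComplex C ℕ)

/-- The subobject of coboundaries in degree `q + 1`, as the kernel of the projection from cocycles
to cohomology. -/
noncomputable abbrev coboundaries (q : ℕ) : C := kernel (K.homologyπ (q + 1))

/-- The differential, as a morphism to the coboundaries. -/
noncomputable abbrev toCoboundaries (q : ℕ) : K.X q ⟶ K.coboundaries q :=
  kernel.lift _ (K.toCycles q (q + 1)) (K.toCycles_comp_homologyπ q (q + 1))

/-- The sequence `0 ⟶ Z^q ⟶ K^q ⟶ B^{q+1} ⟶ 0`. -/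
noncomputable abbrev cyclesSequence (q : ℕ) : ShortComplex C :=
  ShortComplex.mk (K.iCycles q) (K.toCoboundaries q) (by
    rw [← cancel_mono (kernel.ι _), ← cancel_mono (K.iCycles (q + 1))]
    simp)

/-- The sequence `0 ⟶ B^{q+1} ⟶ Z^{q+1} ⟶ H^{q+1} ⟶ 0`. -/
noncomputable abbrev homologySequence (q : ℕ) : ShortComplex C :=
  ShortComplex.mk (kernel.ι (K.homologyπ (q + 1))) (K.homologyπ (q + 1)) (kernel.condition _)

lemma epi_toCoboundaries (q : ℕ) : Epi (K.toCoboundaries q) := by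
  have : (ShortComplex.mk _ _ (K.toCycles_comp_homologyπ q (q + 1))).Exact :=
    ShortComplex.exact_of_g_is_cokernel _ (K.homologyIsCokernel q (q + 1) (by simp))
  exact this.epi_kernelLift

lemma shortExact_cyclesSequence (q : ℕ) : (K.cyclesSequence q).ShortExact where
  exact := by
    refine ShortComplex.exact_of_f_is_kernel _ (KernelFork.IsLimit.ofι' _ _ fun k hk ↦ ?_)
    have hk' := (hk =≫ kernel.ι _) =≫ K.iCycles (q + 1)
    exact ⟨K.liftCycles k (q + 1) (by simp) (by simpa using hk'), by simp⟩
  mono_f := inferInstance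
  epi_g := K.epi_toCoboundaries q

lemma shortExact_homologySequence (q : ℕ) : (K.homologySequence q).ShortExact where
  exact := ShortComplex.exact_of_f_is_kernel _ (kernelIsKernel _)
  mono_f := inferInstance
  epi_g := inferInstance

variable {K L M}

/-- The map induced by a morphism of complexes on coboundaries. -/
noncomputable abbrev coboundariesMap (φ : K ⟶ L) (q : ℕ) : K.coboundaries q ⟶ L.coboundaries q :=
  kernel.map _ _ (cyclesMap φ (q + 1)) (homologyMap φ (q + 1)) (by simp)

/-- The functoriality of `cyclesSequence`. -/
@[simps]
noncomputable def cyclesSequenceMap (φ : K ⟶ L) (q : ℕ) :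
    K.cyclesSequence q ⟶ L.cyclesSequence q where
  τ₁ := cyclesMap φ q
  τ₂ := φ.f q
  τ₃ := coboundariesMap φ q
  comm₂₃ := by
    rw [← cancel_mono (kernel.ι _), ← cancel_mono (L.iCycles (q + 1))]
    simp

/-- The functoriality of `homologySequence`. -/
@[simps]
noncomputable def homologySequenceMap (φ : K ⟶ L) (q : ℕ) :
    K.homologySequence q ⟶ L.homologySequence q where
  τ₁ := coboundariesMap φ q
  τ₂ := cyclesMap φ (q + 1)
  τ₃ := homologyMap φ (q + 1)

/-- In degree zero, `cyclesMap` factors through the map induced on any chosen kernels of the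
differentials. -/
lemma exists_cyclesMap_zero_eq {Z Z' : C} (i : Z ⟶ K.X 0) (hi : i ≫ K.d 0 1 = 0)
    (h : IsLimit (KernelFork.ofι i hi)) (i' : Z' ⟶ L.X 0) (hi' : i' ≫ L.d 0 1 = 0)
    (φ : K ⟶ L) (f : Z ⟶ Z') (comm : i ≫ φ.f 0 = f ≫ i') :
    ∃ (a : K.cycles 0 ⟶ Z) (b : Z' ⟶ L.cycles 0), cyclesMap φ 0 = a ≫ f ≫ b := by
  obtain ⟨a, ha⟩ := KernelFork.IsLimit.lift' h (K.iCycles 0) (by simp)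
  refine ⟨a, L.liftCycles i' 1 (by simp) hi', ?_⟩
  replace ha : a ≫ i = K.iCycles 0 := ha
  rw [← cancel_mono (L.iCycles 0)]
  simp [← comm, reassoc_of% ha]

variable [HasExt.{v} C]

/-- Since `φ` vanishes on H^{q+1}, it pushes Ext^p classes of Z^{q+1} into the image of those of
B^{q+1}; these die under `ψ` by dimension shifting. -/
lemma extKills_cyclesMap_succ {X : C} {p : ℕ} (hp : 0 < p) (q : ℕ) (φ : K ⟶ L) (ψ : L ⟶ M)
    [Injective (M.X q)] (hφ : homologyMap φ (q + 1) = 0)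
    (hψ : ExtKills X (p + 1) (cyclesMap ψ q)) :
    ExtKills X p (cyclesMap (φ ≫ ψ) (q + 1)) := by
  have : Injective (M.cyclesSequence q).X₂ := ‹_›
  have := ExtKills.shift (L.shortExact_cyclesSequence q) (M.shortExact_cyclesSequence q)
    (cyclesSequenceMap ψ q) hp hψ
  rw [cyclesMap_comp]
  exact ExtKills.comp_of_shortExact (L.shortExact_homologySequence q) (homologySequenceMap φ q)
    (homologySequenceMap ψ q) hφ this

/-- The obstruction lies in Ext^1(X, B^{q+1}), which shifts to Ext^2(X, Z^q). -/
lemma exists_lift_cycles_of_extKills {X : C} (q : ℕ) (φ : K ⟶ L) [Injective (L.X q)]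
    (hφ : ExtKills X 2 (cyclesMap φ q)) (t : X ⟶ K.homology (q + 1)) :
    ∃ s : X ⟶ L.cycles (q + 1), s ≫ L.homologyπ (q + 1) = t ≫ homologyMap φ (q + 1) := by
  have : Injective (L.cyclesSequence q).X₂ := ‹_›
  have := ExtKills.shift (K.shortExact_cyclesSequence q) (L.shortExact_cyclesSequence q)
    (cyclesSequenceMap φ q) one_pos hφ
  exact ExtKills.exists_lift (K.shortExact_homologySequence q) (L.shortExact_homologySequence q)
    (homologySequenceMap φ q) this t

/-- Exactness puts `t` in B^{q+1}; the obstruction to lifting it along the differential lies in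
Ext^1(X, Z^q). -/
lemma exists_lift_of_extKills {X : C} (q : ℕ) (hK : K.ExactAt (q + 1)) (φ : K ⟶ L)
    (hφ : ExtKills X 1 (cyclesMap φ q)) (t : X ⟶ K.cycles (q + 1)) :
    ∃ s : X ⟶ L.X q, s ≫ L.toCycles q (q + 1) = t ≫ cyclesMap φ (q + 1) := by
  have h0 : t ≫ K.homologyπ (q + 1) = 0 := hK.isZero_homology.eq_of_tgt _ _
  obtain ⟨s, hs⟩ := ExtKills.exists_lift (K.shortExact_cyclesSequence q)
    (L.shortExact_cyclesSequence q) (cyclesSequenceMap φ q) hφ (kernel.lift _ t h0)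
  exact ⟨s, by simpa using hs =≫ kernel.ι _⟩

end CochainComplex

namespace CategoryTheory.InjectiveResolution

variable {C : Type u} [Category.{v} C] [Abelian C] [HasExt.{v} C]

lemma extKills_cyclesMap {Y Z : C} (I : InjectiveResolution Y) (J : InjectiveResolution Z)
    (f : Y ⟶ Z) (φ : I.cocomplex ⟶ J.cocomplex) (comm : I.ι.f 0 ≫ φ.f 0 = f ≫ J.ι.f 0)
    {X : C} (q p : ℕ) (hp : 0 < p) (h : ExtKills X (p + q) f) :
    ExtKills X p (HomologicalComplex.cyclesMap φ q) := by
  induction q generalizing p with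
  | zero =>
    obtain ⟨a, b, hab⟩ := CochainComplex.exists_cyclesMap_zero_eq (I.ι.f 0)
      I.ι_f_zero_comp_complex_d I.isLimitKernelFork (J.ι.f 0) J.ι_f_zero_comp_complex_d φ f comm
    rw [hab]
    exact (ExtKills.comp_right h b).comp_left a
  | succ q ih =>
    -- The identity of `I` serves as the first map, being zero on the vanishing H^{q+1}.
    rw [← Category.id_comp φ]
    refine CochainComplex.extKills_cyclesMap_succ hp q _ φ ?_ (ih (p + 1) (by lia) ?_)
    · exact (I.cocomplex_exactAt_succ q).isZero_homology.eq_of_src _ _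
    · rwa [show p + 1 + q = p + (q + 1) by lia]

end CategoryTheory.InjectiveResolution

/-! ### Full abelian subcategories and effaceability. -/

namespace CategoryTheory.ObjectProperty

variable {C : Type u} [Category.{v} C] [Abelian C] (P : ObjectProperty C)

/-- A pushout is the cokernel of a map from `X` to the biproduct of `Y` and `Z`. -/
lemma prop_pushout_of_isClosedUnderCokernels [P.IsClosedUnderCokernels]
    [P.IsClosedUnderFiniteProducts] {X Y Z : C} (f : X ⟶ Y) (g : X ⟶ Z) (hX : P X) (hY : P Y)
    (hZ : P Z) : P (pushout f g) :=
  P.prop_of_isColimit_cokernelCofork (IsPushout.of_hasPushout f g).isColimitCokernelCofork hX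
    (P.prop_of_isLimit_binaryFan (BinaryBiproduct.isLimit Y Z) hY hZ)

end CategoryTheory.ObjectProperty

lemma IsEffaceable.of_exists_mono {C : Type u} [Category.{v} C] (P : ObjectProperty C)
    {D : Type u'} [Category.{v'} D] [HasZeroMorphisms D]
    {T : C ⥤ D} (h : ∀ X, P X → ∃ (Y : C) (_ : P Y) (f : X ⟶ Y), Mono f ∧ T.map f = 0) :
    IsEffaceable (P.ι ⋙ T) := fun X ↦ by
  obtain ⟨Y, hY, f, _, hf⟩ := h X.obj X.property
  have : Mono (P.ι.map (P.homMk f : X ⟶ ⟨Y, hY⟩)) := ‹Mono f›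
  exact ⟨⟨Y, hY⟩, P.homMk f, P.ι.mono_of_mono_map this, hf⟩

section

variable {C : Type u} [Category.{v} C] [Abelian C] (P : ObjectProperty C)

/-- In a full abelian subcategory, effaceability of a restricted functor is witnessed by
monomorphisms of the ambient category. -/
lemma IsEffaceable.exists_mono {D : Type u'} [Category.{v'} D] [HasZeroMorphisms D]
    [P.ContainsZero] [P.IsClosedUnderKernels] [P.IsClosedUnderCokernels]
    {T : C ⥤ D} (h : IsEffaceable (P.ι ⋙ T)) {X : C} (hX : P X) :
    ∃ (Y : C) (_ : P Y) (f : X ⟶ Y), Mono f ∧ T.map f = 0 := by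
  obtain ⟨Y, a, _, ha⟩ := h ⟨X, hX⟩
  have := P.preservesMonomorphisms_ι_of_isNormalEpiCategory
  exact ⟨Y.obj, Y.property, P.ι.map a, inferInstance, ha⟩

lemma HasEffaceableExt.exists_mono [EnoughInjectives C] [HasExt.{v} C] [P.ContainsZero]
    [P.IsClosedUnderKernels] [P.IsClosedUnderCokernels]
    (h : HasEffaceableExt P) {X Y : C} (hX : P X) (hY : P Y) {n : ℕ} (hn : 0 < n) :
    ∃ (Z : C) (_ : P Z) (f : Y ⟶ Z), Mono f ∧ ExtKills X n f := by
  have h' : IsEffaceable (P.ι ⋙ Abelian.extFunctorObj.{v} X n) := h X hX n hn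
  obtain ⟨Z, hZ, f, hf, h0⟩ := h'.exists_mono P hY
  exact ⟨Z, hZ, f, hf, fun x ↦ DFunLike.congr_fun (congrArg AddCommGrpCat.Hom.hom h0) x⟩

end

/-! ### Derived functors and adjunction on injective resolutions. -/

namespace CategoryTheory.InjectiveResolution

variable {B : Type u'} [Category.{v'} B] [Abelian B]

lemma comp_comm {X Y Z : B} {I : InjectiveResolution X} {J : InjectiveResolution Y}
    {K : InjectiveResolution Z} {f : X ⟶ Y} {g : Y ⟶ Z} {φ : I.cocomplex ⟶ J.cocomplex}
    {ψ : J.cocomplex ⟶ K.cocomplex} (hφ : I.ι.f 0 ≫ φ.f 0 = f ≫ J.ι.f 0)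
    (hψ : J.ι.f 0 ≫ ψ.f 0 = g ≫ K.ι.f 0) :
    I.ι.f 0 ≫ (φ ≫ ψ).f 0 = (f ≫ g) ≫ K.ι.f 0 :=
  (Category.assoc _ _ _).symm.trans ((hφ =≫ ψ.f 0).trans ((Category.assoc _ _ _).trans
    ((f ≫= hψ).trans (Category.assoc _ _ _).symm)))

variable {A : Type u} [Category.{v} A] [Abelian A] (G : B ⥤ A) [G.Additive]

lemma rightDerived_map_eq_zero_iff [EnoughInjectives B] {Y Z : B} (I : InjectiveResolution Y)
    (J : InjectiveResolution Z) (f : Y ⟶ Z) (φ : I.cocomplex ⟶ J.cocomplex)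
    (comm : I.ι.f 0 ≫ φ.f 0 = f ≫ J.ι.f 0) (n : ℕ) :
    (G.rightDerived n).map f = 0 ↔
      HomologicalComplex.homologyMap ((G.mapHomologicalComplex _).map φ) n = 0 := by
  have h := isoRightDerivedObj_hom_naturality f I J φ comm G n
  rw [← cancel_mono (J.isoRightDerivedObj G n).hom, h, zero_comp]
  exact Preadditive.IsIso.comp_left_eq_zero _ _

variable {G} [PreservesFiniteLimits G]

/-- The zero-cocycles of `G` applied to an injective resolution of `Y` are `G.obj Y`,
compatibly with morphisms. -/
lemma exists_cyclesMap_map_zero_eq {Y Z : B} (I : InjectiveResolution Y)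
    (J : InjectiveResolution Z) (f : Y ⟶ Z) (φ : I.cocomplex ⟶ J.cocomplex)
    (comm : I.ι.f 0 ≫ φ.f 0 = f ≫ J.ι.f 0) :
    ∃ (a : ((G.mapHomologicalComplex _).obj I.cocomplex).cycles 0 ⟶ G.obj Y)
      (b : G.obj Z ⟶ ((G.mapHomologicalComplex _).obj J.cocomplex).cycles 0),
      HomologicalComplex.cyclesMap ((G.mapHomologicalComplex _).map φ) 0 = a ≫ G.map f ≫ b := by
  have hI : G.map (I.ι.f 0) ≫ G.map (I.cocomplex.d 0 1) = 0 := by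
    rw [← G.map_comp, I.ι_f_zero_comp_complex_d, G.map_zero]
  have hJ : G.map (J.ι.f 0) ≫ G.map (J.cocomplex.d 0 1) = 0 := by
    rw [← G.map_comp, J.ι_f_zero_comp_complex_d, G.map_zero]
  refine CochainComplex.exists_cyclesMap_zero_eq
    (K := (G.mapHomologicalComplex _).obj I.cocomplex)
    (L := (G.mapHomologicalComplex _).obj J.cocomplex)
    (G.map (I.ι.f 0)) hI (KernelFork.mapIsLimit _ I.isLimitKernelFork G) (G.map (J.ι.f 0)) hJ
    ((G.mapHomologicalComplex _).map φ) (G.map f) ?_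
  exact (G.map_comp _ _).symm.trans ((congrArg G.map comm).trans (G.map_comp _ _))

end CategoryTheory.InjectiveResolution

namespace CategoryTheory.Adjunction

variable {A : Type u} [Category.{v} A] [Abelian A] {B : Type u'} [Category.{v'} B] [Abelian B]
  {F : A ⥤ B} {G : B ⥤ A} [G.Additive]

/-- Over a map `f` killing `Ext^(q+1)(F.obj X, -)`, a map from `X` to cocycles of `G` applied to an
injective resolution becomes zero in cohomology. -/
lemma comp_homologyMap_eq_zero_of_extKills [HasExt.{v'} B] (adj : F ⊣ G) {X : A} {Y Z : B}
    (I : InjectiveResolution Y) (J : InjectiveResolution Z) (f : Y ⟶ Z)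
    (φ : I.cocomplex ⟶ J.cocomplex) (comm : I.ι.f 0 ≫ φ.f 0 = f ≫ J.ι.f 0) (q : ℕ)
    (hf : ExtKills (F.obj X) (q + 1) f)
    (s : X ⟶ ((G.mapHomologicalComplex _).obj I.cocomplex).cycles (q + 1)) :
    s ≫ HomologicalComplex.homologyπ _ _ ≫
      HomologicalComplex.homologyMap ((G.mapHomologicalComplex _).map φ) (q + 1) = 0 := by
  have := adj.left_adjoint_additive
  let K := (G.mapHomologicalComplex (ComplexShape.up ℕ)).obj I.cocomplex
  let L := (G.mapHomologicalComplex (ComplexShape.up ℕ)).obj J.cocomplex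
  let s' : X ⟶ G.obj (I.cocomplex.X (q + 1)) := s ≫ K.iCycles (q + 1)
  have hs' : s' ≫ G.map (I.cocomplex.d (q + 1) (q + 2)) = 0 := by
    have : K.iCycles (q + 1) ≫ K.d (q + 1) (q + 2) = 0 := K.iCycles_d _ _
    exact (Category.assoc _ _ _).trans ((s ≫= this).trans comp_zero)
  -- Pass to the resolution itself, which is exact, unlike its image under `G`.
  let t : F.obj X ⟶ I.cocomplex.cycles (q + 1) :=
    I.cocomplex.liftCycles ((adj.homEquiv _ _).symm s') (q + 2) (by simp) (by
      rw [← adj.homEquiv_naturality_right_symm, hs', adj.homEquiv_counit, F.map_zero, zero_comp])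
  obtain ⟨r, hr⟩ := CochainComplex.exists_lift_of_extKills q (I.cocomplex_exactAt_succ q) φ
    (I.extKills_cyclesMap J f φ comm q 1 one_pos (by rwa [add_comm])) t
  let r' : X ⟶ G.obj (J.cocomplex.X q) := adj.homEquiv _ _ r
  have hr' : r ≫ J.cocomplex.d q (q + 1) =
      (adj.homEquiv _ _).symm s' ≫ φ.f (q + 1) := by
    simpa [t] using hr =≫ J.cocomplex.iCycles (q + 1)
  have h' : r' ≫ G.map (J.cocomplex.d q (q + 1)) = s' ≫ G.map (φ.f (q + 1)) := by
    rw [← adj.homEquiv_naturality_right, hr', adj.homEquiv_naturality_right,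
      Equiv.apply_symm_apply]
  obtain ⟨u, hu⟩ : ∃ u : X ⟶ L.X q, u ≫ L.d q (q + 1) =
      s ≫ K.iCycles (q + 1) ≫ ((G.mapHomologicalComplex _).map φ).f (q + 1) :=
    ⟨r', h'.trans (Category.assoc _ _ _)⟩
  have h : u ≫ L.toCycles q (q + 1) =
      s ≫ HomologicalComplex.cyclesMap ((G.mapHomologicalComplex _).map φ) (q + 1) := by
    rw [← cancel_mono (L.iCycles (q + 1)), Category.assoc, Category.assoc,
      HomologicalComplex.toCycles_i, HomologicalComplex.cyclesMap_i, hu]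
  rw [HomologicalComplex.homologyπ_naturality, ← reassoc_of% h,
    L.toCycles_comp_homologyπ, comp_zero]

end CategoryTheory.Adjunction

/-! ### Effacing Ext of cocycles. -/

section

variable {A : Type u} [Category.{v} A] [Abelian A] [EnoughInjectives A]
  {B : Type u'} [Category.{v'} B] [Abelian B]
  (A' : ObjectProperty A) [A'.ContainsZero]
  [A'.IsClosedUnderKernels] [A'.IsClosedUnderCokernels]
  (B' : ObjectProperty B)
  [B'.IsClosedUnderCokernels] [B'.IsClosedUnderFiniteProducts]
  {F : A ⥤ B} {G : B ⥤ A}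

/-- The functors `Ext^p_A(X, G(-))` are effaceable on `B'` for `p > 0`. -/
lemma exists_mono_extKills_map [HasExt.{v} A] (hA' : HasEffaceableExt A')
    (adj : F ⊣ G) [F.PreservesMonomorphisms] (hF : ∀ X : A, A' X → B' (F.obj X))
    {X : A} (hX : A' X) {Y : B} (hY : B' Y) (hGY : A' (G.obj Y)) {p : ℕ} (hp : 0 < p) :
    ∃ (Z : B) (_ : B' Z) (f : Y ⟶ Z), Mono f ∧ ExtKills X p (G.map f) := by
  obtain ⟨C, hC, c, _, hc⟩ := HasEffaceableExt.exists_mono A' hA' hX hGY hp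
  -- Pushing out `F.map c` along the counit makes `G` of the resulting mono factor through `c`, by
  -- the triangle identity.
  refine ⟨pushout (F.map c) (adj.counit.app Y),
    B'.prop_pushout_of_isClosedUnderCokernels _ _ (hF _ hGY) (hF _ hC) hY, pushout.inr _ _,
    inferInstance, ?_⟩
  have : G.map (pushout.inr (F.map c) (adj.counit.app Y)) =
      c ≫ adj.unit.app C ≫ G.map (pushout.inl (F.map c) (adj.counit.app Y)) := by
    rw [← adj.unit_naturality_assoc, ← G.map_comp, pushout.condition, G.map_comp,
      adj.right_triangle_components_assoc]
  rw [this]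
  exact hc.comp_right _

variable [EnoughInjectives B] [G.Additive] [PreservesFiniteLimits G] [B'.ContainsZero] [B'.IsClosedUnderKernels]

/-- If the lower right derived functors of `G` are effaceable on `B'`, then `Ext` with values in the
cocycles of `G` applied to injective resolutions is effaceable. -/
lemma exists_mono_extKills_cyclesMap [HasExt.{v} A] (hA' : HasEffaceableExt A')
    (hG : ∀ Y : B, B' Y → A' (G.obj Y))
    (adj : F ⊣ G) [F.PreservesMonomorphisms] (hF : ∀ X : A, A' X → B' (F.obj X))
    (q : ℕ) (hq : ∀ j, 0 < j → j ≤ q → IsEffaceable (B'.ι ⋙ G.rightDerived j))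
    {p : ℕ} (hp : 0 < p) {X : A} (hX : A' X) {Y : B} (hY : B' Y) :
    ∃ (Z : B) (_ : B' Z) (f : Y ⟶ Z)
      (φ : (injectiveResolution Y).cocomplex ⟶ (injectiveResolution Z).cocomplex),
      Mono f ∧ (injectiveResolution Y).ι.f 0 ≫ φ.f 0 = f ≫ (injectiveResolution Z).ι.f 0 ∧
      ExtKills X p (HomologicalComplex.cyclesMap ((G.mapHomologicalComplex _).map φ) q) := by
  induction q generalizing p Y with
  | zero =>
    obtain ⟨Z, hZ, f, hf, h⟩ := exists_mono_extKills_map A' B' hA' adj hF hX hY (hG Y hY) hp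
    have comm := InjectiveResolution.desc_commutes_zero f (injectiveResolution Z)
      (injectiveResolution Y)
    refine ⟨Z, hZ, f, _, hf, comm, ?_⟩
    obtain ⟨a, b, hab⟩ := InjectiveResolution.exists_cyclesMap_map_zero_eq (G := G) _ _ f _ comm
    rw [hab]
    exact (h.comp_right b).comp_left a
  | succ q ih =>
    obtain ⟨Z, hZ, f, _, hf⟩ :=
      IsEffaceable.exists_mono B' (hq (q + 1) (Nat.succ_pos q) le_rfl) hY
    have comm := InjectiveResolution.desc_commutes_zero f (injectiveResolution Z)
      (injectiveResolution Y)
    -- Each cocycle degree gained costs one Ext degree, hence `p + 1`.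
    obtain ⟨W, hW, g, ψ, _, comm', hψ⟩ :=
      ih (fun j h₁ h₂ ↦ hq j h₁ (h₂.trans q.le_succ)) (p := p + 1) p.succ_pos hZ
    refine ⟨W, hW, f ≫ g, InjectiveResolution.desc f _ _ ≫ ψ, inferInstance,
      InjectiveResolution.comp_comm comm comm', ?_⟩
    have : Injective (((G.mapHomologicalComplex _).obj
        (injectiveResolution W).cocomplex).X q) :=
      adj.map_injective _ ((injectiveResolution W).injective q)
    rw [Functor.map_comp]
    exact CochainComplex.extKills_cyclesMap_succ hp q _ _
      ((InjectiveResolution.rightDerived_map_eq_zero_iff G _ _ f _ comm _).1 hf) hψ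

end

theorem theorem3p11
    {A : Type u} [Category.{v} A] [Abelian A] [EnoughInjectives A]
    {B : Type u'} [Category.{v'} B] [Abelian B] [EnoughInjectives B]
    -- the full abelian subcategory of `A` (the inclusion is exact), closed under isomorphisms
    (A' : ObjectProperty A) [A'.IsClosedUnderIsomorphisms] [A'.ContainsZero]
    [A'.IsClosedUnderKernels] [A'.IsClosedUnderCokernels] [A'.IsClosedUnderFiniteProducts]
    -- the full abelian subcategory of `B` (the inclusion is exact), closed under isomorphisms
    (B' : ObjectProperty B) [B'.IsClosedUnderIsomorphisms] [B'.ContainsZero]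
    [B'.IsClosedUnderKernels] [B'.IsClosedUnderCokernels] [B'.IsClosedUnderFiniteProducts]
    (hA' : HasEffaceableExt A') (hB' : HasEffaceableExt B')
    (F : A ⥤ B) (G : B ⥤ A) [G.Additive] [PreservesFiniteLimits G]
    (hG : ∀ (q : ℕ) (Y : B), B' Y → A' ((G.rightDerived q).obj Y))
    (adj : F ⊣ G) [PreservesFiniteLimits F] (hF : ∀ X : A, A' X → B' (F.obj X))
    (e : ℕ) (he : 0 < e) :
    IsEffaceable (B'.ι ⋙ G.rightDerived e) := by
  have : HasExt.{v} A := hasExt_of_enoughInjectives.{v} A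
  have : HasExt.{v'} B := hasExt_of_enoughInjectives.{v'} B
  induction e using Nat.strong_induction_on with
  | _ e ih =>
  obtain ⟨q, rfl⟩ := Nat.exists_eq_succ_of_ne_zero he.ne'
  refine IsEffaceable.of_exists_mono B' fun Y hY ↦ ?_
  -- The test object is R^{q+1}G(Y) itself, with `p = 2` for the lifting obstruction.
  obtain ⟨Z, hZ, f, φ, _, comm, hφ⟩ := exists_mono_extKills_cyclesMap A' B' hA'
    (fun Y hY ↦ A'.prop_of_iso (G.rightDerivedZeroIsoSelf.app Y) (hG 0 Y hY)) adj hF q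
    (fun j hj hjq ↦ ih j (Nat.lt_succ_of_le hjq) hj) two_pos (hG (q + 1) Y hY) hY
  obtain ⟨W, hW, g, _, hg⟩ :=
    HasEffaceableExt.exists_mono B' hB' (hF _ (hG (q + 1) Y hY)) hZ q.succ_pos
  have comm' := InjectiveResolution.desc_commutes_zero g (injectiveResolution W)
    (injectiveResolution Z)
  have : Injective (((G.mapHomologicalComplex (ComplexShape.up ℕ)).obj
      (injectiveResolution Z).cocomplex).X q) :=
    adj.map_injective _ ((injectiveResolution Z).injective q)
  -- The map being lifted is an isomorphism, so it can be cancelled at the end.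
  obtain ⟨s, hs⟩ := CochainComplex.exists_lift_cycles_of_extKills q _ hφ
    ((injectiveResolution Y).isoRightDerivedObj G (q + 1)).hom
  refine ⟨W, hW, f ≫ g, inferInstance, ?_⟩
  rw [InjectiveResolution.rightDerived_map_eq_zero_iff G (injectiveResolution Y)
    (injectiveResolution W) (f ≫ g) (φ ≫ InjectiveResolution.desc g _ _)
    (InjectiveResolution.comp_comm comm comm'), Functor.map_comp,
    HomologicalComplex.homologyMap_comp]
  have := adj.comp_homologyMap_eq_zero_of_extKills _ _ g _ comm' q hg s
  rw [reassoc_of% hs] at this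
  exact (Preadditive.IsIso.comp_left_eq_zero
    ((injectiveResolution Y).isoRightDerivedObj G (q + 1)).hom _).1 ((Category.assoc _ _ _).symm.trans this)
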